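/- Theorem 2.1. Let $G$ be a finite group, $V\neq 0$ a finite-dimensional complex Hilbert space, $\pi\colon G\to U(V)$ a unitary representation, $H\le G$ a subgroup, and $f\colon G\to X$ a surjection onto a finite set $X$ with $f(a)=f(b)$ if and only if $aH=bH$ (an instance of the coset identification problem). Let $t\ge 0$ be an integer and $P$ a real number. A $t$-query adaptive quantum algorithm consists of an integer $N\ge 0$, a unit vector $\psi\in V\otimes\mathbb{C}^N$, unitary operators $U_1,\dots,U_t$ on $V\otimes\mathbb{C}^N$, and a POVM $\{E_x\}_{x\in X}$ on $V\otimes\mathbb{C}^N$ (positive operators with $\sum_x E_x=I$); its output states are $$\psi_a=U_t(\pi(a)\otimes I)U_{t-1}(\pi(a)\otimes I)\cdots U_1(\pi(a)\otimes I)\psi,\qquad a\in G.$$ A $t$-query nonadaptive (parallel) quantum algorithm consists of an integer $N\ge 0$, a unit vector $\psi\in V^{\otimes t}\otimes\mathbb{C}^N$, and a POVM $\{E_x\}_{x\in X}$ on $V^{\otimes t}\otimes\mathbb{C}^N$; its output states are $\psi_a=(\pi(a)^{\otimes t}\otimes I)\psi$, $a\in G$. In both cases the success probability of the algorithm is $$\frac1{|G|}\sum_{a\in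 G}\langle\psi_a|E_{f(a)}|\psi_a\rangle .$$ Then there exists a $t$-query adaptive quantum algorithm with success probability $P$ if and only if there exists a $t$-query nonadaptive quantum algorithm with success probability $P$. -/

import Mathlib

open scoped TensorProduct

namespace QuantumOracle

noncomputable section

universe u v w

/-- A positive operator-valued measure on the Hilbert space `W` with outcomes in the finite
set `X`: positive operators `E x` that sum to the identity. -/
structure POVM (X : Type v) [Fintype X] (W : Type u) [NormedAddCommGroup W]
    [InnerProductSpace ℂ W] where
  E : X → W →ₗ[ℂ] W
  isPositive : ∀ x, (E x).IsPositive
  sum_eq_one : ∑ x, E x = 1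

/-- The probability `⟨φ| E_x |φ⟩` that measuring the state `φ` yields `x`. The inner product is
real because `E_x` is positive. -/
def POVM.prob {X : Type v} [Fintype X] {W : Type u} [NormedAddCommGroup W]
    [InnerProductSpace ℂ W] (M : POVM X W) (φ : W) (x : X) : ℝ :=
  (inner ℂ φ (M.E x φ)).re

/-- A bundled complex inner product space, used to define tensor powers by recursion. -/
structure HilbSpace : Type (u + 1) where
  carrier : Type u
  [normedAddCommGroup : NormedAddCommGroup carrier]
  [innerProductSpace : InnerProductSpace ℂ carrier]

attribute [instance] HilbSpace.normedAddCommGroup HilbSpace.innerProductSpace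

/-- The tensor power `V ⊗ (V ⊗ (⋯ ⊗ ℂ))` with `t` factors `V`, with the tensor product inner
product. The base case is the one-dimensional Hilbert space, in the universe of `V`. -/
def tensorPower (V : Type u) [NormedAddCommGroup V] [InnerProductSpace ℂ V] : ℕ → HilbSpace.{u}
  | 0 => ⟨EuclideanSpace ℂ PUnit.{u + 1}⟩
  | t + 1 => ⟨V ⊗[ℂ] (tensorPower V t).carrier⟩

section

variable {V : Type u} [NormedAddCommGroup V] [InnerProductSpace ℂ V]

/-- The unitary `U ⊗ U ⊗ ⋯ ⊗ U` on the `t`-th tensor power. -/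
def unitaryPower (U : V ≃ₗᵢ[ℂ] V) :
    (t : ℕ) → (tensorPower V t).carrier ≃ₗᵢ[ℂ] (tensorPower V t).carrier
  | 0 => LinearIsometryEquiv.refl ℂ (EuclideanSpace ℂ PUnit.{u + 1})
  | t + 1 => TensorProduct.congrIsometry U (unitaryPower U t)

/-- The unitary `U ⊗ I` on `W ⊗ ℂ^N`. -/
def withWorkspace {W : Type u} [NormedAddCommGroup W] [InnerProductSpace ℂ W]
    (U : W ≃ₗᵢ[ℂ] W) (N : ℕ) :
    (W ⊗[ℂ] EuclideanSpace ℂ (Fin N)) ≃ₗᵢ[ℂ] (W ⊗[ℂ] EuclideanSpace ℂ (Fin N)) :=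
  TensorProduct.congrIsometry U (LinearIsometryEquiv.refl ℂ (EuclideanSpace ℂ (Fin N)))

end

/-- A `t`-query adaptive quantum algorithm: a workspace dimension `N`, an initial unit vector
of `V ⊗ ℂ^N`, unitaries `U 0, …, U (t - 1)` applied after the successive queries, and a final
measurement with outcomes in `X`. -/
structure AdaptiveAlgorithm (V : Type u) [NormedAddCommGroup V] [InnerProductSpace ℂ V]
    (X : Type v) [Fintype X] (t : ℕ) where
  N : ℕ
  ψ : V ⊗[ℂ] EuclideanSpace ℂ (Fin N)
  norm_ψ : ‖ψ‖ = 1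
  U : Fin t → (V ⊗[ℂ] EuclideanSpace ℂ (Fin N)) ≃ₗᵢ[ℂ] (V ⊗[ℂ] EuclideanSpace ℂ (Fin N))
  M : POVM X (V ⊗[ℂ] EuclideanSpace ℂ (Fin N))

/-- The vector `U_t O U_{t-1} O ⋯ U_1 O ψ`. -/
def interleave {W : Type u} [NormedAddCommGroup W] [InnerProductSpace ℂ W]
    (O : W ≃ₗᵢ[ℂ] W) (ψ : W) : (t : ℕ) → (Fin t → W ≃ₗᵢ[ℂ] W) → W
  | 0, _ => ψ
  | t + 1, U => U (Fin.last t) (O (interleave O ψ t fun i => U i.castSucc))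

/-- A `t`-query nonadaptive (parallel) quantum algorithm: an auxiliary dimension `N`, a unit
vector of `V^{⊗t} ⊗ ℂ^N`, and a measurement with outcomes in `X`. -/
structure NonadaptiveAlgorithm (V : Type u) [NormedAddCommGroup V] [InnerProductSpace ℂ V]
    (X : Type v) [Fintype X] (t : ℕ) where
  N : ℕ
  ψ : (tensorPower V t).carrier ⊗[ℂ] EuclideanSpace ℂ (Fin N)
  norm_ψ : ‖ψ‖ = 1
  M : POVM X ((tensorPower V t).carrier ⊗[ℂ] EuclideanSpace ℂ (Fin N))

section

variable {V : Type u} [NormedAddCommGroup V] [InnerProductSpace ℂ V]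
  {X : Type v} [Fintype X] {t : ℕ} {Y : Type w} [Fintype Y]

/-- The state that the adaptive algorithm measures when the oracle is `O`. -/
def AdaptiveAlgorithm.output (A : AdaptiveAlgorithm V X t) (O : V ≃ₗᵢ[ℂ] V) :
    V ⊗[ℂ] EuclideanSpace ℂ (Fin A.N) :=
  interleave (withWorkspace O A.N) A.ψ t A.U

/-- The success probability of an adaptive algorithm at computing `f`, averaged over a hidden
element of `Y` chosen uniformly, with oracles `π a`. -/
def AdaptiveAlgorithm.successProb (A : AdaptiveAlgorithm V X t) (π : Y → V ≃ₗᵢ[ℂ] V)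
    (f : Y → X) : ℝ :=
  (1 / (Fintype.card Y : ℝ)) * ∑ a, A.M.prob (A.output (π a)) (f a)

/-- The state `(O^{⊗t} ⊗ I) ψ` that the nonadaptive algorithm measures when the oracle
is `O`. -/
def NonadaptiveAlgorithm.output (A : NonadaptiveAlgorithm V X t) (O : V ≃ₗᵢ[ℂ] V) :
    (tensorPower V t).carrier ⊗[ℂ] EuclideanSpace ℂ (Fin A.N) :=
  withWorkspace (unitaryPower O t) A.N A.ψ

/-- The success probability of a nonadaptive algorithm at computing `f`, averaged over a hidden
element of `Y` chosen uniformly, with oracles `π a`. -/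
def NonadaptiveAlgorithm.successProb (A : NonadaptiveAlgorithm V X t) (π : Y → V ≃ₗᵢ[ℂ] V)
    (f : Y → X) : ℝ :=
  (1 / (Fintype.card Y : ℝ)) * ∑ a, A.M.prob (A.output (π a)) (f a)

end

/-- `f` is onto, constant on left cosets of `H`, and distinct on distinct left cosets. -/
structure IsCosetLabelling {G : Type w} [Group G] (H : Subgroup G) {X : Type v} (f : G → X) :
    Prop where
  surjective : Function.Surjective f
  eq_iff : ∀ a b : G, f a = f b ↔ (a : G ⧸ H) = (b : G ⧸ H)

end

end QuantumOracle

/-!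
A measurement of a family of states sees only their Gram matrix (`POVM.exists_transfer`), so
the question is which Gram matrices the two kinds of algorithms can produce.

Parallel queries can be made one after the other, with the idle registers swapped into the
workspace (`exists_interleave_eq`). Hence adaptive algorithms simulate nonadaptive ones, for any
set of oracles.

The converse uses the group. Let `ρ = π^{⊗t}`. The output of a `t`-query adaptive algorithm is a
linear function `ψ_a = Q (ρ a)` of `ρ a` (`exists_interleave_eq_linear`); in other words, its
coordinates are matrix coefficients of `V^{⊗t}`. The space of matrix coefficients is invariant
under translations on both sides, so for each outcome `x`, with `s_x ∈ G` such that `f s_x = x`,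
the function `g ↦ √E_x ψ_{s_x g}` is again linear in `ρ g`. Put these functions side by side and
divide by `√|G|`, to get `h : G → ⨁_x V ⊗ ℂᴺ`. As the `E_x` sum to the identity,
`∑_g ‖h g‖² = 1`, and the sum `∑_{g ∈ H} ‖h g‖²` is the success probability of the adaptive
algorithm, because `s_x H` is the fibre of `f` over `x`.

Consider the unit vectors `u_a = (g ↦ h (g⁻¹ a))` of `ℓ²(G, ⨁_x V ⊗ ℂᴺ)`. Measuring the position
`g` and answering `f g` is correct for the hidden element `a` precisely when `g⁻¹ a ∈ H`, hence
with probability `∑_{k ∈ H} ‖h k‖²`, whatever `a` is. It remains to see that the `u_a` have the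
Gram matrix of the output states `(ρ a ⊗ I) ψ` of a parallel algorithm. They are the images of
`(ρ a ⊗ I) Ω`, for a fixed vector `Ω` of `V^{⊗t} ⊗ ℂⁿ`, under an equivariant linear map `Φ`. Taking
`ψ = √(Φ* Φ) Ω` corrects for `Φ` not being isometric, as `√(Φ* Φ)` commutes with the action of `G`
(`exists_nonadaptive_state`).
-/

open scoped TensorProduct

namespace QuantumOracle

/-! ### Positive operators and measurements -/

/-- The square root of a positive operator, as a linear map. It commutes with everything that
commutes with the operator, so that it is equivariant whenever the operator is. -/
theorem exists_sqrt_of_isPositive {W : Type*} [NormedAddCommGroup W] [InnerProductSpace ℂ W]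
    [FiniteDimensional ℂ W] {T : W →ₗ[ℂ] W} (hT : T.IsPositive) :
    ∃ S : W →ₗ[ℂ] W, (∀ x y, inner ℂ (S x) (S y) = inner ℂ x (T y)) ∧
      ∀ L : W →ₗ[ℂ] W, Commute L T → Commute L S := by
  have : CompleteSpace W := FiniteDimensional.complete ℂ W
  set T' : W →L[ℂ] W := LinearMap.toContinuousLinearMap T with hT'
  have hpos : 0 ≤ T' := by
    rw [ContinuousLinearMap.nonneg_iff_isPositive]
    exact LinearMap.isPositive_toContinuousLinearMap_iff _ |>.2 hT
  set S' : W →L[ℂ] W := CFC.sqrt T' with hS'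
  have hSpos : 0 ≤ S' := CFC.sqrt_nonneg _
  have hSS : S' * S' = T' := CFC.sqrt_mul_sqrt_self _ hpos
  refine ⟨S'.toLinearMap, fun x y => ?_, fun L hL => ?_⟩
  · have h1 := (ContinuousLinearMap.nonneg_iff_isPositive _ |>.1 hSpos).inner_left_eq_inner_right
      x (S' y)
    have h2 : S' (S' y) = T y := by
      rw [← mul_apply_eq_comp, hSS]; rfl
    simpa [h2] using h1
  · have h1 : Commute T' (LinearMap.toContinuousLinearMap L) := by
      ext x
      exact (LinearMap.congr_fun hL.eq x).symm
    have h2 : Commute S' (LinearMap.toContinuousLinearMap L) := h1.cfcₙ_nnreal _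
    ext x
    exact (DFunLike.congr_fun h2.eq x).symm

/-- Only the Gram matrix of a family of states matters for measuring it: if `S z` and `Φ z` have
the same inner products, every measurement of the `Φ z` is mimicked by one of the `S z`. The
measurement pulls back along the partial isometry `K` that sends `S z` to `Φ z` and vanishes on
the orthogonal complement of the range of `S`; the projection onto that complement is added to
the operator of an arbitrary outcome. -/
theorem POVM.exists_transfer {X : Type*} [Fintype X] [Nonempty X] {Z W W' : Type*}
    [AddCommGroup Z] [Module ℂ Z]
    [NormedAddCommGroup W] [InnerProductSpace ℂ W] [FiniteDimensional ℂ W]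
    [NormedAddCommGroup W'] [InnerProductSpace ℂ W'] [FiniteDimensional ℂ W']
    (S : Z →ₗ[ℂ] W') (Φ : Z →ₗ[ℂ] W)
    (h : ∀ x y, inner ℂ (S x) (S y) = inner ℂ (Φ x) (Φ y)) (M : POVM X W) :
    ∃ M' : POVM X W', ∀ z x, M'.prob (S z) x = M.prob (Φ z) x := by
  classical
  obtain ⟨x₀⟩ := ‹Nonempty X›
  obtain ⟨σ, hσ⟩ := S.rangeRestrict.exists_rightInverse_of_surjective S.range_rangeRestrict
  have hσ' : ∀ w : S.range, S (σ w) = w := fun w =>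
    congrArg Subtype.val (LinearMap.congr_fun hσ w)
  set p : W' →ₗ[ℂ] W' := S.range.starProjection.toLinearMap with hp
  set K : W' →ₗ[ℂ] W := Φ ∘ₗ σ ∘ₗ S.range.orthogonalProjectionOnto.toLinearMap with hK
  have hpS : ∀ z, p (S z) = S z := fun z =>
    S.range.starProjection_eq_self_iff.2 (LinearMap.mem_range_self S z)
  have hpi : ∀ x y, inner ℂ (p x) (p y) = inner ℂ x (p y) := fun x y => by
    have h1 := S.range.inner_starProjection_left_eq_right x (p y)
    have h2 : p (p y) = p y :=
      S.range.starProjection_eq_self_iff.2 (S.range.starProjection_apply_mem y)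
    exact h1.trans (congrArg (inner ℂ x) h2)
  have hKK : ∀ x y, inner ℂ (K x) (K y) = inner ℂ x (p y) := fun x y => by
    rw [← hpi]
    simp only [hK, LinearMap.comp_apply, ← h, hσ']
    rfl
  have hKS : ∀ z, K (S z) = Φ z := fun z => by
    have h0 : S (σ (S.range.orthogonalProjectionOnto (S z)) - z) = 0 := by
      rw [map_sub, hσ', sub_eq_zero]
      exact hpS z
    have h1 := h (σ (S.range.orthogonalProjectionOnto (S z)) - z)
      (σ (S.range.orthogonalProjectionOnto (S z)) - z)
    rw [h0, inner_zero_left, eq_comm, inner_self_eq_zero, map_sub, sub_eq_zero] at h1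
    exact h1
  have hKadj : K.adjoint ∘ₗ K = p := by
    refine LinearMap.ext fun y => ext_inner_left ℂ fun x => ?_
    rw [LinearMap.comp_apply, LinearMap.adjoint_inner_right, hKK]
  have hq : (1 - p).IsPositive := by
    have h1 := isStarProjection_starProjection (U := S.rangeᗮ) (𝕜 := ℂ)
    rw [Submodule.starProjection_orthogonal] at h1
    exact ContinuousLinearMap.IsPositive.of_isStarProjection h1
  refine ⟨⟨fun x => K.adjoint ∘ₗ M.E x ∘ₗ K + if x = x₀ then 1 - p else 0, fun x => ?_, ?_⟩,
    fun z x => ?_⟩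
  · refine ((M.isPositive x).adjoint_conj K).add ?_
    split_ifs
    exacts [hq, LinearMap.isPositive_zero]
  · rw [Finset.sum_add_distrib, Finset.sum_ite_eq' Finset.univ x₀ (fun _ => 1 - p),
      if_pos (Finset.mem_univ _)]
    have : ∑ x, K.adjoint ∘ₗ M.E x ∘ₗ K = K.adjoint ∘ₗ (∑ x, M.E x) ∘ₗ K := by
      ext y; simp
    rw [this, M.sum_eq_one, Module.End.one_eq_id, LinearMap.id_comp, hKadj, add_sub_cancel]
  · have : (if x = x₀ then 1 - p else 0) (S z) = 0 := by
      split_ifs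
      · simp [hpS]
      · rfl
    simp only [POVM.prob, LinearMap.add_apply, this, add_zero, LinearMap.comp_apply,
      LinearMap.adjoint_inner_right, hKS]

theorem POVM.sum_prob {X : Type*} [Fintype X] {W : Type*} [NormedAddCommGroup W]
    [InnerProductSpace ℂ W] (M : POVM X W) (φ : W) : ∑ x, M.prob φ x = ‖φ‖ ^ 2 := by
  simp only [POVM.prob]
  rw [← Complex.re_sum, ← inner_sum, ← LinearMap.sum_apply, M.sum_eq_one]
  exact inner_self_eq_norm_sq (𝕜 := ℂ) φ

/-! ### Isometries -/

/-- Any two isometric embeddings into a finite-dimensional space differ by a unitary. -/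
theorem exists_linearIsometryEquiv_comp_eq {W Z : Type*} [NormedAddCommGroup W]
    [InnerProductSpace ℂ W] [NormedAddCommGroup Z] [InnerProductSpace ℂ Z] [FiniteDimensional ℂ Z]
    (J J' : W →ₗᵢ[ℂ] Z) : ∃ U : Z ≃ₗᵢ[ℂ] Z, ∀ x, U (J' x) = J x := by
  let L : J'.toLinearMap.range →ₗᵢ[ℂ] Z := J.comp J'.equivRange.symm.toLinearIsometry
  refine ⟨L.extend.toLinearIsometryEquiv rfl, fun x => ?_⟩
  have h := L.extend_apply (J'.equivRange x)
  simpa [L] using h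

theorem exists_linearIsometry_of_finrank_le {W Z : Type*} [NormedAddCommGroup W]
    [InnerProductSpace ℂ W] [FiniteDimensional ℂ W] [NormedAddCommGroup Z] [InnerProductSpace ℂ Z]
    [FiniteDimensional ℂ Z] (h : Module.finrank ℂ W ≤ Module.finrank ℂ Z) :
    Nonempty (W →ₗᵢ[ℂ] Z) := by
  let b := stdOrthonormalBasis ℂ W
  let b' := stdOrthonormalBasis ℂ Z
  have ho : Orthonormal ℂ (fun i => b' (Fin.castLE h i)) :=
    b'.orthonormal.comp _ (Fin.castLE_injective h)
  refine ⟨(b.toBasis.constr ℂ fun i => b' (Fin.castLE h i)).isometryOfOrthonormal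
    (v := b.toBasis) (by simp) ?_⟩
  convert ho using 2
  simp

section

universe u

variable {V : Type u} [NormedAddCommGroup V] [InnerProductSpace ℂ V]

theorem finiteDimensional_tensorPower [FiniteDimensional ℂ V] (t : ℕ) :
    FiniteDimensional ℂ (tensorPower V t).carrier := by
  induction t with
  | zero => exact inferInstanceAs (FiniteDimensional ℂ (EuclideanSpace ℂ PUnit))
  | succ t ih => exact inferInstanceAs (FiniteDimensional ℂ (V ⊗[ℂ] (tensorPower V t).carrier))

@[simp]
theorem withWorkspace_tmul {W : Type u} [NormedAddCommGroup W] [InnerProductSpace ℂ W]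
    (U : W ≃ₗᵢ[ℂ] W) (N : ℕ) (w : W) (c : EuclideanSpace ℂ (Fin N)) :
    withWorkspace U N (w ⊗ₜ c) = U w ⊗ₜ c := rfl

theorem norm_interleave {W : Type u} [NormedAddCommGroup W] [InnerProductSpace ℂ W]
    (O : W ≃ₗᵢ[ℂ] W) (ψ : W) (t : ℕ) (U : Fin t → W ≃ₗᵢ[ℂ] W) :
    ‖interleave O ψ t U‖ = ‖ψ‖ := by
  induction t with
  | zero => rfl
  | succ t ih => simp only [interleave, LinearIsometryEquiv.norm_map, ih]

/-! ### Adaptive queries simulate parallel queries -/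

/-- An adaptive algorithm can make `t` parallel queries one at a time, keeping the registers that
are not being queried in its workspace. The isometry `J` says how the result is finally stored;
it is arbitrary so that the induction can rearrange registers between queries, moving the
first factor of `V^{⊗(t+1)}` into the ancilla `K` for the first `t` queries. The bound on `N` leaves
room in the workspace for all the idle registers. -/
theorem exists_interleave_eq [FiniteDimensional ℂ V] [Nontrivial V] (N t : ℕ) :
    ∀ {K : Type u} [NormedAddCommGroup K] [InnerProductSpace ℂ K] [FiniteDimensional ℂ K],
    Module.finrank ℂ ((tensorPower V t).carrier ⊗[ℂ] K) ≤ N →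
    ∀ (J : (tensorPower V t).carrier ⊗[ℂ] K →ₗᵢ[ℂ] V ⊗[ℂ] EuclideanSpace ℂ (Fin N))
      (ψ : (tensorPower V t).carrier ⊗[ℂ] K),
    ∃ (ψ₀ : V ⊗[ℂ] EuclideanSpace ℂ (Fin N))
      (U : Fin t → (V ⊗[ℂ] EuclideanSpace ℂ (Fin N)) ≃ₗᵢ[ℂ] (V ⊗[ℂ] EuclideanSpace ℂ (Fin N))),
      ∀ O : V ≃ₗᵢ[ℂ] V, interleave (withWorkspace O N) ψ₀ t U =
        J (TensorProduct.map (unitaryPower O t).toLinearEquiv.toLinearMap LinearMap.id ψ) := by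
  induction t with
  | zero =>
    intro K _ _ _ _ J ψ
    refine ⟨J ψ, Fin.elim0, fun O => ?_⟩
    have : TensorProduct.map (unitaryPower O 0).toLinearEquiv.toLinearMap LinearMap.id ψ = ψ := by
      change TensorProduct.map LinearMap.id LinearMap.id ψ = ψ
      rw [TensorProduct.map_id]; rfl
    rw [this]
    rfl
  | succ t ih =>
    intro K _ _ _ hN J ψ
    have := finiteDimensional_tensorPower (V := V) t
    have hV : 0 < Module.finrank ℂ V := Module.finrank_pos
    set T := (tensorPower V t).carrier
    have hN' : Module.finrank ℂ V * Module.finrank ℂ T * Module.finrank ℂ K ≤ N := by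
      rw [← Module.finrank_tensorProduct, ← Module.finrank_tensorProduct]
      exact hN
    obtain ⟨J₀⟩ : Nonempty (T ⊗[ℂ] K →ₗᵢ[ℂ] EuclideanSpace ℂ (Fin N)) := by
      refine exists_linearIsometry_of_finrank_le ?_
      rw [Module.finrank_tensorProduct, finrank_euclideanSpace_fin]
      refine le_trans ?_ hN'
      rw [mul_assoc]
      exact Nat.le_mul_of_pos_left _ hV
    -- `J₂` stores all registers but the first in the workspace, so that the query `O ⊗ I` acts
    -- on the first register.
    let J₂ : (V ⊗[ℂ] T) ⊗[ℂ] K →ₗᵢ[ℂ] V ⊗[ℂ] EuclideanSpace ℂ (Fin N) :=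
      (J₀.lTensor V).comp (TensorProduct.assocIsometry ℂ V T K).toLinearIsometry
    -- `e` hands the first register over to the workspace.
    let e : (V ⊗[ℂ] T) ⊗[ℂ] K ≃ₗᵢ[ℂ] T ⊗[ℂ] (V ⊗[ℂ] K) :=
      ((TensorProduct.commIsometry ℂ V T).rTensor K).trans (TensorProduct.assocIsometry ℂ T V K)
    obtain ⟨ψ₀, U, hU⟩ := ih (K := V ⊗[ℂ] K) (by
      rw [Module.finrank_tensorProduct, Module.finrank_tensorProduct]
      refine le_trans (le_of_eq ?_) hN'
      ring) (J₂.comp e.symm.toLinearIsometry) (e ψ)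
    obtain ⟨U', hU'⟩ := exists_linearIsometryEquiv_comp_eq J J₂
    refine ⟨ψ₀, Fin.snoc U U', fun O => ?_⟩
    have key : ∀ x : (V ⊗[ℂ] T) ⊗[ℂ] K, withWorkspace O N (J₂ (e.symm
        (TensorProduct.map (unitaryPower O t).toLinearEquiv.toLinearMap LinearMap.id (e x)))) =
        J₂ (TensorProduct.map (TensorProduct.map O.toLinearEquiv.toLinearMap
          (unitaryPower O t).toLinearEquiv.toLinearMap) LinearMap.id x) := by
      let R := (unitaryPower O t).toLinearEquiv.toLinearMap
      have h : (withWorkspace O N).toLinearEquiv.toLinearMap ∘ₗ J₂.toLinearMap ∘ₗ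
          e.symm.toLinearEquiv.toLinearMap ∘ₗ TensorProduct.map R LinearMap.id ∘ₗ
          e.toLinearEquiv.toLinearMap = J₂.toLinearMap ∘ₗ
          TensorProduct.map (TensorProduct.map O.toLinearEquiv.toLinearMap R) LinearMap.id :=
        TensorProduct.ext_threefold fun v s k => rfl
      exact LinearMap.congr_fun h
    simp only [interleave, Fin.snoc_last, Fin.snoc_castSucc]
    rw [hU]
    exact (congrArg U' (key ψ)).trans (hU' _)

theorem exists_adaptive_of_nonadaptive [FiniteDimensional ℂ V] [Nontrivial V] {X Y : Type*}
    [Fintype X] [Nonempty X] [Fintype Y] {t : ℕ} (B : NonadaptiveAlgorithm V X t)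
    (π : Y → V ≃ₗᵢ[ℂ] V) (f : Y → X) :
    ∃ A : AdaptiveAlgorithm V X t, A.successProb π f = B.successProb π f := by
  have := finiteDimensional_tensorPower (V := V) t
  -- `exists_interleave_eq` needs a workspace in the universe of `V`.
  let K := EuclideanSpace ℂ (ULift.{u} (Fin B.N))
  let r : EuclideanSpace ℂ (Fin B.N) ≃ₗᵢ[ℂ] K :=
    LinearIsometryEquiv.piLpCongrLeft 2 ℂ ℂ Equiv.ulift.symm
  let e : (tensorPower V t).carrier ⊗[ℂ] EuclideanSpace ℂ (Fin B.N) ≃ₗᵢ[ℂ]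
    (tensorPower V t).carrier ⊗[ℂ] K := r.lTensor _
  let N := Module.finrank ℂ ((tensorPower V t).carrier ⊗[ℂ] K)
  obtain ⟨J⟩ : Nonempty ((tensorPower V t).carrier ⊗[ℂ] K →ₗᵢ[ℂ]
      V ⊗[ℂ] EuclideanSpace ℂ (Fin N)) := by
    refine exists_linearIsometry_of_finrank_le ?_
    have h : Module.finrank ℂ (V ⊗[ℂ] EuclideanSpace ℂ (Fin N)) = Module.finrank ℂ V * N := by
      rw [Module.finrank_tensorProduct, finrank_euclideanSpace_fin]
    exact (Nat.le_mul_of_pos_left _ Module.finrank_pos).trans_eq h.symm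
  obtain ⟨ψ₀, U, hU⟩ := exists_interleave_eq N t le_rfl J (e B.ψ)
  have hout : ∀ O : V ≃ₗᵢ[ℂ] V, interleave (withWorkspace O N) ψ₀ t U = J (e (B.output O)) := by
    intro O
    rw [hU]
    congr 1
    rw [NonadaptiveAlgorithm.output]
    generalize B.ψ = x
    induction x with
    | zero => simp
    | add x y hx hy => simp only [map_add, hx, hy]
    | tmul y k => rfl
  obtain ⟨M, hM⟩ := B.M.exists_transfer (J.toLinearMap ∘ₗ e.toLinearEquiv.toLinearMap)
    LinearMap.id (fun x y => by simp)
  refine ⟨⟨N, ψ₀, ?_, U, M⟩, ?_⟩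
  -- Any oracle gives the norm of `ψ₀`, since all the steps are unitary.
  · rw [← norm_interleave (withWorkspace (LinearIsometryEquiv.refl ℂ V) N) ψ₀ t U,
      hout, J.norm_map, e.norm_map,
      NonadaptiveAlgorithm.output, LinearIsometryEquiv.norm_map, B.norm_ψ]
  · simp only [AdaptiveAlgorithm.successProb, NonadaptiveAlgorithm.successProb,
      AdaptiveAlgorithm.output, hout]
    congr 1
    exact Finset.sum_congr rfl fun a _ => hM (B.output (π a)) (f a)

/-! ### Output states of adaptive algorithms -/

/-- The output of a `t`-query adaptive algorithm depends linearly on `O^{⊗t}`: one more query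
contributes a bilinear expression in `O` and `O^{⊗t}`, and `End V ⊗ End V^{⊗t} ≃ End V^{⊗(t+1)}`. -/
theorem exists_interleave_eq_linear [FiniteDimensional ℂ V] {N : ℕ}
    (ψ : V ⊗[ℂ] EuclideanSpace ℂ (Fin N)) (t : ℕ)
    (U : Fin t → (V ⊗[ℂ] EuclideanSpace ℂ (Fin N)) ≃ₗᵢ[ℂ] (V ⊗[ℂ] EuclideanSpace ℂ (Fin N))) :
    ∃ Q : Module.End ℂ (tensorPower V t).carrier →ₗ[ℂ] V ⊗[ℂ] EuclideanSpace ℂ (Fin N),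
      ∀ O : V ≃ₗᵢ[ℂ] V, interleave (withWorkspace O N) ψ t U =
        Q (unitaryPower O t).toLinearEquiv.toLinearMap := by
  induction t with
  | zero =>
    -- `V^{⊗0}` is one-dimensional, so the identity has trace `1`.
    refine ⟨(LinearMap.trace ℂ (EuclideanSpace ℂ PUnit.{u + 1})).smulRight ψ, fun O => ?_⟩
    change ψ = (LinearMap.trace ℂ (EuclideanSpace ℂ PUnit.{u + 1}) LinearMap.id) • ψ
    rw [LinearMap.trace_id, finrank_euclideanSpace]
    simp
  | succ t ih =>
    obtain ⟨Q, hQ⟩ := ih fun i => U i.castSucc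
    have := finiteDimensional_tensorPower (V := V) t
    set T := (tensorPower V t).carrier
    let β : Module.End ℂ V →ₗ[ℂ] Module.End ℂ T →ₗ[ℂ] V ⊗[ℂ] EuclideanSpace ℂ (Fin N) :=
      LinearMap.mk₂ ℂ (fun A B => U (Fin.last t) (A.rTensor _ (Q B)))
        (fun A A' B => by simp [LinearMap.rTensor_add])
        (fun c A B => by simp [LinearMap.rTensor_smul])
        (fun A B B' => by simp) (fun c A B => by simp)
    refine ⟨TensorProduct.lift β ∘ₗ (homTensorHomEquiv ℂ V T V T).symm.toLinearMap, fun O => ?_⟩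
    have h : (homTensorHomEquiv ℂ V T V T).symm (TensorProduct.map O.toLinearEquiv.toLinearMap
        (unitaryPower O t).toLinearEquiv.toLinearMap) =
        O.toLinearEquiv.toLinearMap ⊗ₜ (unitaryPower O t).toLinearEquiv.toLinearMap := by
      rw [LinearEquiv.symm_apply_eq, homTensorHomEquiv_apply]
      rfl
    rw [interleave, hQ]
    exact (congrArg (TensorProduct.lift β) h).symm

theorem unitaryPower_one (t : ℕ) : unitaryPower (1 : V ≃ₗᵢ[ℂ] V) t = 1 := by
  induction t with
  | zero => rfl
  | succ t ih =>
    rw [unitaryPower, ih]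
    exact TensorProduct.congrIsometry_refl_refl

theorem unitaryPower_mul (U U' : V ≃ₗᵢ[ℂ] V) (t : ℕ) :
    unitaryPower (U * U') t = unitaryPower U t * unitaryPower U' t := by
  induction t with
  | zero => rfl
  | succ t ih =>
    rw [unitaryPower, ih]
    refine LinearIsometryEquiv.ext fun x => ?_
    exact LinearMap.congr_fun (TensorProduct.map_comp U.toLinearEquiv.toLinearMap
      (unitaryPower U t).toLinearEquiv.toLinearMap U'.toLinearEquiv.toLinearMap
      (unitaryPower U' t).toLinearEquiv.toLinearMap) x

/-- The representation `π^{⊗t}` on the tensor power `V^{⊗t}`. -/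
noncomputable def tensorPowerRep {G : Type*} [Group G] (π : G →* (V ≃ₗᵢ[ℂ] V)) (t : ℕ) :
    G →* ((tensorPower V t).carrier ≃ₗᵢ[ℂ] (tensorPower V t).carrier) where
  toFun a := unitaryPower (π a) t
  map_one' := by rw [map_one, unitaryPower_one]
  map_mul' a b := by rw [map_mul, unitaryPower_mul]

/-! ### Parallel states with a prescribed Gram matrix -/

/-- `End T` with left multiplication is `T ⊗ ℂⁿ` with the action on the first factor. The
identification `Γ` is only linear: nothing is claimed about inner products. -/
theorem exists_vectorization {T : Type u} [NormedAddCommGroup T] [InnerProductSpace ℂ T]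
    [FiniteDimensional ℂ T] :
    ∃ (n : ℕ) (Γ : (T ⊗[ℂ] EuclideanSpace ℂ (Fin n)) →ₗ[ℂ] Module.End ℂ T)
      (Ω : T ⊗[ℂ] EuclideanSpace ℂ (Fin n)), Γ Ω = 1 ∧ ∀ (O : T ≃ₗᵢ[ℂ] T) z,
        Γ (withWorkspace O n z) = O.toLinearEquiv.toLinearMap * Γ z := by
  let φ : EuclideanSpace ℂ (Fin (Module.finrank ℂ T)) ≃ₗ[ℂ] Module.Dual ℂ T :=
    LinearEquiv.ofFinrankEq _ _ (by simp [Subspace.dual_finrank_eq])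
  let Γ : (T ⊗[ℂ] EuclideanSpace ℂ (Fin (Module.finrank ℂ T))) ≃ₗ[ℂ] Module.End ℂ T :=
    ((TensorProduct.congr (LinearEquiv.refl ℂ T) φ).trans (TensorProduct.comm ℂ _ _)).trans
      (dualTensorHomEquiv ℂ T T)
  refine ⟨_, Γ.toLinearMap, Γ.symm 1, Γ.apply_symm_apply 1, fun O z => ?_⟩
  induction z with
  | zero => simp
  | add x y hx hy => simp only [map_add, hx, hy, mul_add]
  | tmul τ c =>
    ext v
    simp [Γ]

/-- The states `u_a = (g ↦ Q (ρ (g⁻¹ a)))` of `ℓ²(G, K)` can be replaced, for the purpose of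
measurements, by states `(ρ a ⊗ I) ψ` of `T ⊗ ℂⁿ`. The map `Φ : T ⊗ ℂⁿ → ℓ²(G, K)` below is
`G`-equivariant for translations and sends `(ρ a ⊗ I) Ω` to `u_a`, but it need not be isometric;
by equivariance `S = √(Φ* Φ)` commutes with `G`, so `ψ = S Ω` has `(ρ a ⊗ I) ψ = S (ρ a ⊗ I) Ω`,
and these vectors have the inner products of the `u_a`. -/
theorem exists_nonadaptive_state {G : Type*} [Group G] [Fintype G] {T : Type u}
    [NormedAddCommGroup T] [InnerProductSpace ℂ T] [FiniteDimensional ℂ T] {K : Type*}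
    [NormedAddCommGroup K] [InnerProductSpace ℂ K]
    [FiniteDimensional ℂ K] {X : Type*} [Fintype X] [Nonempty X]
    (ρ : G →* (T ≃ₗᵢ[ℂ] T)) (Q : Module.End ℂ T →ₗ[ℂ] K)
    (M : POVM X (PiLp 2 fun _ : G => K)) :
    ∃ (n : ℕ) (ψ : T ⊗[ℂ] EuclideanSpace ℂ (Fin n))
      (M' : POVM X (T ⊗[ℂ] EuclideanSpace ℂ (Fin n))),
      ‖ψ‖ = ‖WithLp.toLp 2 fun g => Q (ρ g⁻¹).toLinearEquiv.toLinearMap‖ ∧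
      ∀ a x, M'.prob (withWorkspace (ρ a) n ψ) x =
        M.prob (WithLp.toLp 2 fun g => Q (ρ (g⁻¹ * a)).toLinearEquiv.toLinearMap) x := by
  obtain ⟨n, Γ, Ω, hΩ, hΓ⟩ := exists_vectorization (T := T)
  let Φ : (T ⊗[ℂ] EuclideanSpace ℂ (Fin n)) →ₗ[ℂ] PiLp 2 fun _ : G => K :=
    (WithLp.linearEquiv 2 ℂ (G → K)).symm.toLinearMap ∘ₗ LinearMap.pi fun g =>
      Q ∘ₗ LinearMap.mulLeft ℂ (ρ g⁻¹).toLinearEquiv.toLinearMap ∘ₗ Γ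
  have hΦ : ∀ z g, Φ z g = Q ((ρ g⁻¹).toLinearEquiv.toLinearMap * Γ z) := fun z g => rfl
  have hρ : ∀ a b, (ρ (a * b)).toLinearEquiv.toLinearMap =
      (ρ a).toLinearEquiv.toLinearMap * (ρ b).toLinearEquiv.toLinearMap := fun a b => by
    rw [map_mul]; rfl
  have hΦρ : ∀ a z g, Φ (withWorkspace (ρ a) n z) g = Φ z (a⁻¹ * g) := fun a z g => by
    rw [hΦ, hΦ, hΓ, ← mul_assoc, ← hρ, mul_inv_rev, inv_inv]
  have hΦi : ∀ a x y, inner ℂ (Φ (withWorkspace (ρ a) n x)) (Φ (withWorkspace (ρ a) n y)) =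
      inner ℂ (Φ x) (Φ y) := fun a x y => by
    simp only [PiLp.inner_apply, hΦρ]
    exact Equiv.sum_comp (Equiv.mulLeft a⁻¹) fun g => inner ℂ (Φ x g) (Φ y g)
  obtain ⟨S, hS, hcomm⟩ := exists_sqrt_of_isPositive (LinearMap.isPositive_adjoint_comp_self Φ)
  have hSΦ : ∀ x y, inner ℂ (S x) (S y) = inner ℂ (Φ x) (Φ y) := fun x y => by
    rw [hS, LinearMap.comp_apply, LinearMap.adjoint_inner_right]
  have hSρ : ∀ a z, withWorkspace (ρ a) n (S z) = S (withWorkspace (ρ a) n z) := fun a z => by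
    refine LinearMap.congr_fun (hcomm (withWorkspace (ρ a) n).toLinearEquiv.toLinearMap ?_).eq z
    refine LinearMap.ext fun y => ext_inner_left ℂ fun x => ?_
    obtain ⟨x, rfl⟩ := (withWorkspace (ρ a) n).surjective x
    change inner ℂ _ (withWorkspace (ρ a) n (Φ.adjoint (Φ y))) =
      inner ℂ _ (Φ.adjoint (Φ (withWorkspace (ρ a) n y)))
    rw [LinearIsometryEquiv.inner_map_map, LinearMap.adjoint_inner_right,
      LinearMap.adjoint_inner_right, hΦi]
  obtain ⟨M', hM'⟩ := M.exists_transfer S Φ hSΦ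
  refine ⟨n, S Ω, M', ?_, fun a x => ?_⟩
  · have h : Φ Ω = WithLp.toLp 2 fun g => Q (ρ g⁻¹).toLinearEquiv.toLinearMap := by
      ext g
      rw [hΦ, hΩ, mul_one]
    rw [← h, norm_eq_sqrt_re_inner (𝕜 := ℂ), norm_eq_sqrt_re_inner (𝕜 := ℂ) (Φ Ω), hSΦ]
  · rw [hSρ, hM']
    congr 1
    ext g
    rw [hΦ, hΓ, hΩ, mul_one, ← hρ]

/-- The measurement on `ℓ²(G, K)` that reads the position `g` in `G` and outputs `f g`. -/
noncomputable def positionPOVM {G : Type*} [Fintype G] {K : Type*} [NormedAddCommGroup K]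
    [InnerProductSpace ℂ K] {X : Type*} [Fintype X] [DecidableEq X] (f : G → X) :
    POVM X (PiLp 2 fun _ : G => K) where
  E x := (WithLp.linearEquiv 2 ℂ (G → K)).symm.toLinearMap ∘ₗ LinearMap.pi fun g =>
    if f g = x then PiLp.projₗ 2 (fun _ : G => K) g else 0
  isPositive x := by
    refine ⟨fun v w => ?_, fun v => ?_⟩
    · simp only [PiLp.inner_apply]
      refine Finset.sum_congr rfl fun g _ => ?_
      by_cases h : f g = x <;> simp [h]
    · simp only [PiLp.inner_apply, map_sum]
      refine Finset.sum_nonneg fun g _ => ?_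
      by_cases h : f g = x
      · simpa [h] using inner_self_nonneg (𝕜 := ℂ) (x := v g)
      · simp [h]
  sum_eq_one := by
    ext v g
    simp [LinearMap.sum_apply, apply_ite (fun l : (PiLp 2 fun _ : G => K) →ₗ[ℂ] K => l v)]

theorem positionPOVM_prob {G : Type*} [Fintype G] {K : Type*} [NormedAddCommGroup K]
    [InnerProductSpace ℂ K] {X : Type*} [Fintype X] [DecidableEq X] (f : G → X)
    (v : PiLp 2 fun _ : G => K) (x : X) :
    (positionPOVM f).prob v x = ∑ g, if f g = x then ‖v g‖ ^ 2 else 0 := by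
  rw [POVM.prob, PiLp.inner_apply, Complex.re_sum]
  refine Finset.sum_congr rfl fun g _ => ?_
  by_cases h : f g = x
  · simpa [positionPOVM, h] using inner_self_eq_norm_sq (𝕜 := ℂ) (v g)
  · simp [positionPOVM, h]

/-! ### Parallel queries simulate adaptive queries -/

/-- The parallel algorithm measures the position in the states `u_a = (g ↦ h (g⁻¹ a))`, where
`h g ∈ ⨁_x V ⊗ ℂᴺ` has the components `√E_x ψ_{s_x g} / √|G|`, for the output states `ψ_b` and the
measurement `E` of the adaptive algorithm and representatives `s_x` of the fibres of `f`. -/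
theorem exists_nonadaptive_of_adaptive [FiniteDimensional ℂ V] {G : Type*} [Group G] [Fintype G]
    {X : Type*} [Fintype X] (π : G →* (V ≃ₗᵢ[ℂ] V)) {H : Subgroup G} {f : G → X}
    (hf : IsCosetLabelling H f) {t : ℕ} (A : AdaptiveAlgorithm V X t) :
    ∃ B : NonadaptiveAlgorithm V X t, B.successProb π f = A.successProb π f := by
  classical
  have : Nonempty X := ⟨f 1⟩
  have := finiteDimensional_tensorPower (V := V) t
  let ρ := tensorPowerRep π t
  obtain ⟨Q, hQ⟩ := exists_interleave_eq_linear A.ψ t A.U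
  have hQρ : ∀ a, Q (ρ a).toLinearEquiv.toLinearMap = A.output (π a) := fun a => (hQ (π a)).symm
  choose s hs using hf.surjective
  choose S hS _ using fun x => exists_sqrt_of_isPositive (A.M.isPositive x)
  have hSnorm : ∀ x v, ‖S x v‖ ^ 2 = A.M.prob v x := fun x v => by
    rw [POVM.prob, ← hS]
    exact (inner_self_eq_norm_sq (𝕜 := ℂ) _).symm
  have hcard : (0 : ℝ) < Fintype.card G := by exact_mod_cast Fintype.card_pos
  let c : ℂ := ((√(Fintype.card G : ℝ))⁻¹ : ℝ)
  have hc : ‖c‖ ^ 2 = 1 / (Fintype.card G : ℝ) := by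
    simp only [c, Complex.norm_real, Real.norm_eq_abs, sq_abs, inv_pow]
    rw [Real.sq_sqrt hcard.le, one_div]
  -- `Q'` is chosen so that `Q' (ρ g)` is the vector `h g`.
  let Q' : Module.End ℂ (tensorPower V t).carrier →ₗ[ℂ]
      PiLp 2 fun _ : X => V ⊗[ℂ] EuclideanSpace ℂ (Fin A.N) :=
    (WithLp.linearEquiv 2 ℂ (X → V ⊗[ℂ] EuclideanSpace ℂ (Fin A.N))).symm.toLinearMap ∘ₗ
      LinearMap.pi fun x => c • (S x ∘ₗ Q ∘ₗ
        LinearMap.mulLeft ℂ (ρ (s x)).toLinearEquiv.toLinearMap)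
  have hQ' : ∀ g, ‖Q' (ρ g).toLinearEquiv.toLinearMap‖ ^ 2 =
      1 / (Fintype.card G : ℝ) * ∑ x, A.M.prob (A.output (π (s x * g))) x := fun g => by
    rw [PiLp.norm_sq_eq_of_L2, Finset.mul_sum]
    refine Finset.sum_congr rfl fun x _ => ?_
    rw [← hSnorm, ← hQρ, ← hc, ← mul_pow, ← norm_smul, map_mul]
    rfl
  obtain ⟨n, ψ, M, hψ, hM⟩ := exists_nonadaptive_state ρ Q' (positionPOVM f)
  refine ⟨⟨n, ψ, ?_, M⟩, ?_⟩
  · rw [hψ, ← sq_eq_sq₀ (norm_nonneg _) zero_le_one, PiLp.norm_sq_eq_of_L2]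
    simp only [hQ']
    rw [← Finset.mul_sum, Finset.sum_comm]
    have h : ∀ x, ∑ g : G, A.M.prob (A.output (π (s x * g⁻¹))) x =
        ∑ b : G, A.M.prob (A.output (π b)) x := fun x =>
      Equiv.sum_comp ((Equiv.inv G).trans (Equiv.mulLeft (s x)))
        fun b => A.M.prob (A.output (π b)) x
    simp only [h]
    rw [Finset.sum_comm]
    simp only [POVM.sum_prob, AdaptiveAlgorithm.output, norm_interleave, A.norm_ψ]
    simp [hcard.ne']
  -- The parallel algorithm succeeds with the same probability for every hidden `a`.
  · have h : ∀ a, M.prob (withWorkspace (ρ a) n ψ) (f a) = A.successProb π f := fun a => by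
      rw [hM, positionPOVM_prob, AdaptiveAlgorithm.successProb]
      simp only [hQ']
      simp only [← mul_ite_zero, ← Finset.mul_sum]
      congr 1
      have hx : ∀ x, ∑ g : G, (if f g = f a then
          A.M.prob (A.output (π (s x * (g⁻¹ * a)))) x else 0) =
          ∑ b : G, if f b = x then A.M.prob (A.output (π b)) x else 0 := fun x => by
        -- With `b = s_x g⁻¹ a`, both conditions say that `g⁻¹ a ∈ H`.
        refine Fintype.sum_equiv (((Equiv.inv G).trans (Equiv.mulRight a)).trans
          (Equiv.mulLeft (s x))) _ _ fun g => ?_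
        have : f g = f a ↔ f (s x) = f (s x * (g⁻¹ * a)) := by
          rw [hf.eq_iff, hf.eq_iff, QuotientGroup.eq, QuotientGroup.eq, inv_mul_cancel_left]
        rw [hs, eq_comm (a := x)] at this
        simp [this]
      calc _ = ∑ g : G, ∑ x, (if f g = f a then
            A.M.prob (A.output (π (s x * (g⁻¹ * a)))) x else 0) :=
            Finset.sum_congr rfl fun g _ => by split_ifs <;> simp
        _ = ∑ b : G, ∑ x, if f b = x then A.M.prob (A.output (π b)) x else 0 := by
            rw [Finset.sum_comm, Finset.sum_congr rfl fun x _ => hx x, Finset.sum_comm]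
        _ = _ := by simp
    rw [NonadaptiveAlgorithm.successProb]
    change 1 / (Fintype.card G : ℝ) * ∑ a, M.prob (withWorkspace (ρ a) n ψ) (f a) = _
    simp only [h]
    simp [hcard.ne']

end

end QuantumOracle

theorem theorem2p1 {G : Type*} [Group G] [Fintype G] {X : Type*} [Fintype X]
    {V : Type*} [NormedAddCommGroup V] [InnerProductSpace ℂ V] [FiniteDimensional ℂ V]
    [Nontrivial V] (π : G →* (V ≃ₗᵢ[ℂ] V)) (H : Subgroup G) (f : G → X)
    (hf : QuantumOracle.IsCosetLabelling H f) (t : ℕ) (P : ℝ) :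
    (∃ A : QuantumOracle.AdaptiveAlgorithm V X t, A.successProb π f = P) ↔
      (∃ B : QuantumOracle.NonadaptiveAlgorithm V X t, B.successProb π f = P) := by
  constructor
  · rintro ⟨A, rfl⟩
    exact QuantumOracle.exists_nonadaptive_of_adaptive π hf A
  · rintro ⟨B, rfl⟩
    have : Nonempty X := ⟨f 1⟩
    exact QuantumOracle.exists_adaptive_of_nonadaptive B π f
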